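/- Let $R$ be $\mathbb{Z}$ or a countable field. All chain complexes are $\mathbb{Z}$-graded (unbounded) complexes of $R$-modules, and signs follow the Koszul convention. Let $\mathcal{V}=\{\mathcal{V}(n)\}_{n\ge 0}$ be a symmetric operad in chain complexes (with unit in $\mathcal{V}(1)$ and structure maps $\mathcal{V}(n)\otimes\mathcal{V}(k_1)\otimes\cdots\otimes\mathcal{V}(k_n)\to\mathcal{V}(k_1+\cdots+k_n)$) such that 1. there is a morphism of operads $\delta:\mathcal{V}\to\mathcal{V}\otimes\mathfrak{S}$, where $\mathfrak{S}$ is the Barratt–Eccles operad over $R$ ($\mathfrak{S}(n)$ is the normalized chain complex of the universal cover of $K(S_n,1)$) and $\otimes$ is the aritywise tensor product of operads, whose composite with the projection $1\otimes\epsilon:\mathcal{V}\otimes\mathfrak{S}\to\mathcal{V}$ given by the augmentations $\epsilon_n:\mathfrak{S}(n)\to R$ is the identity of $\mathcal{V}$; 2. each $\mathcal{V}(n)$ is $RS_n$-projective (the underlying graded module, in each degree) and of finite type, i.e. finitely generated in each degree; 3. $\mathcal{V}(1)=R$, generated by the unit of the operad. A $\mathcal{V}$-coalgebra is a chain complex $C$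 with a morphism of operads $\mathcal{V}\to\mathrm{CoEnd}(C)$, where $\mathrm{CoEnd}(C)(n)=\mathrm{Hom}_R(C,C^{\otimes n})$. A morphism of $\mathcal{V}$-coalgebras is a chain map of degree $0$ that commutes with all the structure maps $C\to C^{\otimes n}$ given by elements of $\mathcal{V}(n)$. A sub-coalgebra of $C$ is a subcomplex with a $\mathcal{V}$-coalgebra structure for which the inclusion into $C$ is a morphism of $\mathcal{V}$-coalgebras. An $R$-module is nearly free if each of its countable submodules is free. Let $C$ be a $\mathcal{V}$-coalgebra whose underlying module is nearly free, and let $\{C_\alpha\}$ be the family of all countable sub-coalgebras of $C$, ordered by inclusion. Then $$C=\varinjlim C_\alpha .$$ Explicitly: the family $\{C_\alpha\}$ is directed, and every inclusion $C_\alpha\subseteq C_\beta$ is a morphism of $\mathcal{V}$-coalgebras; every element of $C$ lies in some $C_\alpha$; and for every $\mathcal{V}$-coalgebra $D$, every family of coalgebra morphisms $\varphi_\alpha:C_\alpha\to D$ compatible with the inclusions is induced by exactly one coalgebra morphism $\psi:C\to D$. -/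

import Mathlib

open scoped TensorProduct

universe u v w u'

namespace DGOperad

/-! ### Multilinear preliminaries -/

section Multilinear

variable {R : Type u} [CommRing R]

theorem exists_pairing {E : Type u'} [AddCommGroup E] [Module R E] :
    ∀ (n : ℕ) (A : Fin n → Type v) (B : Fin n → Type w)
      [∀ i, AddCommGroup (A i)] [∀ i, Module R (A i)]
      [∀ i, AddCommGroup (B i)] [∀ i, Module R (B i)],
      ∃ L : MultilinearMap R A (MultilinearMap R B E) →ₗ[R]
          MultilinearMap R (fun i => A i ⊗[R] B i) E,
        ∀ Φ a b, L Φ (fun i => a i ⊗ₜ[R] b i) = Φ a b := by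
  intro n
  induction n with
  | zero =>
    intro A B _ _ _ _
    refine ⟨{ toFun := fun Φ => MultilinearMap.constOfIsEmpty R _ (Φ (fun i => i.elim0) (fun i => i.elim0))
              map_add' := ?_, map_smul' := ?_ }, ?_⟩
    · intro x y; ext; simp
    · intro x y; ext; simp
    · intro Φ a b
      have ha : a = fun i => i.elim0 := Subsingleton.elim _ _
      have hb : b = fun i => i.elim0 := Subsingleton.elim _ _
      subst ha; subst hb; rfl
  | succ n ih =>
    intro A B _ _ _ _
    obtain ⟨L, hL⟩ := ih (fun i => A i.succ) (fun i => B i.succ)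
    let cB := (multilinearCurryLeftEquiv R B E).toLinearMap
    let cA := (multilinearCurryLeftEquiv R A (MultilinearMap R B E)).toLinearMap
    let step : MultilinearMap R A (MultilinearMap R B E) →ₗ[R] A 0 →ₗ[R] B 0 →ₗ[R]
        MultilinearMap R (fun i : Fin n => A i.succ ⊗[R] B i.succ) E :=
      { toFun := fun Φ => LinearMap.mk₂ R
          (fun a b => L (((LinearMap.applyₗ b) ∘ₗ cB).compMultilinearMap (cA Φ a)))
          (by intro a a' b; rw [← map_add]; congr 1; ext; simp)
          (by intro c a b; rw [← map_smul]; congr 1; ext; simp)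
          (by intro a b b'; rw [← map_add]; congr 1; ext; simp)
          (by intro c a b; rw [← map_smul]; congr 1; ext; simp)
        map_add' := by
          intro Φ Ψ; refine LinearMap.ext₂ fun a b => ?_
          simp only [LinearMap.mk₂_apply, LinearMap.add_apply]
          rw [← map_add]; congr 1
        map_smul' := by
          intro c Φ; refine LinearMap.ext₂ fun a b => ?_
          simp only [LinearMap.mk₂_apply, LinearMap.smul_apply, RingHom.id_apply]
          rw [← map_smul]; congr 1 }
    refine ⟨(multilinearCurryLeftEquiv R (fun i => A i ⊗[R] B i) E).symm.toLinearMap ∘ₗ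
      (TensorProduct.lift.equiv (RingHom.id R) (A 0) (B 0) _).toLinearMap ∘ₗ step, ?_⟩
    intro Φ a b
    simp [step, multilinearCurryLeftEquiv]
    have := hL (((LinearMap.applyₗ (b 0)) ∘ₗ cB).compMultilinearMap (cA Φ (a 0)))
      (Fin.tail a) (Fin.tail b)
    erw [this]
    simp [cA, cB]

theorem exists_flattening {M : Type v} [AddCommGroup M] [Module R M]
    {E : Type w} [AddCommGroup E] [Module R E] :
    ∀ (n : ℕ) (k : Fin n → ℕ),
      ∃ L : MultilinearMap R (fun _ : (i : Fin n) × Fin (k i) => M) E →ₗ[R]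
          MultilinearMap R (fun i : Fin n => ⨂[R] _ : Fin (k i), M) E,
        ∀ Φ (x : ∀ i, Fin (k i) → M),
          L Φ (fun i => PiTensorProduct.tprod R (x i)) = Φ (fun s => x s.1 s.2) := by
  intro n
  induction n with
  | zero =>
    intro k
    refine ⟨{ toFun := fun Φ => MultilinearMap.constOfIsEmpty R _ (Φ (fun _ => 0))
              map_add' := ?_, map_smul' := ?_ }, ?_⟩
    · intro x y; ext; simp
    · intro x y; ext; simp
    · intro Φ a
      exact congrArg Φ (funext fun s => s.1.elim0)
  | succ n ih =>
    intro k
    obtain ⟨L, hL⟩ := ih (fun i => k i.succ)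
    let e : ((i : Fin (n + 1)) × Fin (k i)) ≃
        Fin (k 0) ⊕ ((i : Fin n) × Fin (k i.succ)) :=
      { toFun := fun s => Fin.cases (motive := fun i => Fin (k i) → Fin (k 0) ⊕ ((i : Fin n) × Fin (k i.succ))) (fun j => Sum.inl j) (fun i j => Sum.inr ⟨i, j⟩) s.1 s.2
        invFun := Sum.elim (fun j => ⟨0, j⟩) (fun s => ⟨s.1.succ, s.2⟩)
        left_inv := by
          rintro ⟨i, j⟩
          induction i using Fin.cases <;> rfl
        right_inv := by rintro (j | ⟨i, j⟩) <;> rfl }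
    let c : MultilinearMap R (fun _ : (i : Fin (n + 1)) × Fin (k i) => M) E →ₗ[R]
        MultilinearMap R (fun _ : Fin (k 0) => M)
          (MultilinearMap R (fun _ : (i : Fin n) × Fin (k i.succ) => M) E) :=
      (MultilinearMap.currySumEquiv (R := R) (N := fun _ => M) (M₂ := E)).toLinearMap ∘ₗ
        (MultilinearMap.domDomCongrLinearEquiv R R M E e).toLinearMap
    let st : MultilinearMap R (fun _ : Fin (k 0) => M)
          (MultilinearMap R (fun _ : (i : Fin n) × Fin (k i.succ) => M) E) →ₗ[R]
        MultilinearMap R (fun _ : Fin (k 0) => M)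
          (MultilinearMap R (fun i : Fin n => ⨂[R] _ : Fin (k i.succ), M) E) :=
      { toFun := fun Ψ => L.compMultilinearMap Ψ
        map_add' := by intro x y; ext; simp
        map_smul' := by intro x y; ext; simp }
    refine ⟨(multilinearCurryLeftEquiv R (fun i : Fin (n+1) => ⨂[R] _ : Fin (k i), M) E).symm.toLinearMap ∘ₗ
      (PiTensorProduct.lift (R := R)).toLinearMap ∘ₗ st ∘ₗ c, ?_⟩
    intro Φ x
    simp [multilinearCurryLeftEquiv]
    have := hL (c Φ (x 0)) (fun i => x i.succ)
    simp only [st, LinearMap.coe_mk, AddHom.coe_mk]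
    refine Eq.trans ?_ (this.trans ?_)
    · rfl
    · change Φ _ = Φ _
      congr 1; funext ⟨i, j⟩
      induction i using Fin.cases <;> rfl

/-- The multilinear rearrangement map `∏ᵢ (Aᵢ ⊗ Bᵢ) → (⨂ᵢ Aᵢ) ⊗ (⨂ᵢ Bᵢ)` (without signs): the
unique multilinear map with `(aᵢ ⊗ bᵢ)ᵢ ↦ (⨂ᵢ aᵢ) ⊗ (⨂ᵢ bᵢ)`; see `interchange_tmul`. -/
noncomputable def interchange {n : ℕ} (A : Fin n → Type v) (B : Fin n → Type w)
    [∀ i, AddCommGroup (A i)] [∀ i, Module R (A i)]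
    [∀ i, AddCommGroup (B i)] [∀ i, Module R (B i)] :
    MultilinearMap R (fun i => A i ⊗[R] B i) ((⨂[R] i, A i) ⊗[R] (⨂[R] i, B i)) :=
  (exists_pairing (R := R) (E := (⨂[R] i, A i) ⊗[R] (⨂[R] i, B i)) n A B).choose
    { toFun := fun a => (TensorProduct.mk R _ _ (PiTensorProduct.tprod R a)).compMultilinearMap
        (PiTensorProduct.tprod R)
      map_update_add' := by intro _ a i x y; ext b; simp
      map_update_smul' := by intro _ a i c x; ext b; simp [TensorProduct.smul_tmul'] }

theorem interchange_tmul {n : ℕ} (A : Fin n → Type v) (B : Fin n → Type w)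
    [∀ i, AddCommGroup (A i)] [∀ i, Module R (A i)]
    [∀ i, AddCommGroup (B i)] [∀ i, Module R (B i)] (a : ∀ i, A i) (b : ∀ i, B i) :
    interchange (R := R) A B (fun i => a i ⊗ₜ[R] b i) =
      PiTensorProduct.tprod R a ⊗ₜ[R] PiTensorProduct.tprod R b :=
  (exists_pairing (R := R) (E := (⨂[R] i, A i) ⊗[R] (⨂[R] i, B i)) n A B).choose_spec _ a b

/-- The concatenation map `M^{⊗k₁} ⊗ ⋯ ⊗ M^{⊗kₙ} → M^{⊗(k₁+⋯+kₙ)}`, see `flatten_tprod`. -/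
noncomputable def flatten (M : Type v) [AddCommGroup M] [Module R M] {n : ℕ} (k : Fin n → ℕ) :
    (⨂[R] i : Fin n, ⨂[R] _ : Fin (k i), M) →ₗ[R] (⨂[R] _ : Fin (∑ i, k i), M) :=
  PiTensorProduct.lift
    ((exists_flattening (R := R) (M := M) (E := ⨂[R] _ : Fin (∑ i, k i), M) n k).choose
      ((PiTensorProduct.tprod R).domDomCongr finSigmaFinEquiv.symm))

theorem flatten_tprod (M : Type v) [AddCommGroup M] [Module R M] {n : ℕ} (k : Fin n → ℕ)
    (x : ∀ i, Fin (k i) → M) :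
    flatten (R := R) M k (PiTensorProduct.tprod R fun i => PiTensorProduct.tprod R (x i)) =
      PiTensorProduct.tprod R
        (fun l => x (finSigmaFinEquiv.symm l).1 (finSigmaFinEquiv.symm l).2) := by
  rw [flatten, PiTensorProduct.lift.tprod,
    (exists_flattening (R := R) (M := M) (E := ⨂[R] _ : Fin (∑ i, k i), M) n k).choose_spec]
  rfl

end Multilinear

/-! ### Differential graded modules -/

section Graded

variable {R : Type u} [CommRing R] {M : Type v} [AddCommGroup M] [Module R M]

/-- The projection of a `ℤ`-graded module onto the sum of its components of degree congruent to
`e` modulo 2. -/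
noncomputable def parityProj {gr : ℤ → Submodule R M} (h : DirectSum.IsInternal gr) (e : Fin 2) :
    M →ₗ[R] M :=
  (DirectSum.toModule R ℤ M
      (fun k => if k % 2 = ((e : ℕ) : ℤ) then (gr k).subtype else 0)) ∘ₗ
    (LinearEquiv.ofBijective (DirectSum.coeLinearMap gr) h).symm.toLinearMap

/-- The sign involution of a `ℤ`-graded module, `x ↦ (-1) ^ deg x • x`. -/
noncomputable def signInv {gr : ℤ → Submodule R M} (h : DirectSum.IsInternal gr) : M →ₗ[R] M :=
  parityProj h 0 - parityProj h 1

end Graded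

/-- An (unbounded) chain complex of `R`-modules, given by its underlying module (the direct sum of
all components), the grading and the differential of degree `-1`. -/
structure DGModule (R : Type u) [CommRing R] where
  carrier : Type v
  [addCommGroup : AddCommGroup carrier]
  [module : Module R carrier]
  gr : ℤ → Submodule R carrier
  internal : DirectSum.IsInternal gr
  d : carrier →ₗ[R] carrier
  d_mem : ∀ k, ∀ x ∈ gr k, d x ∈ gr (k - 1)
  d_d : ∀ x, d (d x) = 0

attribute [instance] DGModule.addCommGroup DGModule.module

/-- The sign exponent of a permutation of graded factors: factor `i`, of degree `q i`, is moved to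
position `e i`, and each pair of factors whose order is reversed contributes the product of its
degrees. -/
def permSign {a b : ℕ} (e : Fin a ≃ Fin b) (q : Fin a → ℤ) : ℤˣ :=
  (∑ i, ∑ j, if i < j ∧ e j < e i then q i * q j else 0).negOnePow

/-- The parity of an index of `parityProj` as an integer. -/
def par {n : ℕ} (ε : Fin n → Fin 2) (i : Fin n) : ℤ := ((ε i : ℕ) : ℤ)

namespace DGModule

variable {R : Type u} [CommRing R] (C : DGModule.{u, v} R)

/-- The underlying module of the `n`-fold tensor power `C ⊗ ⋯ ⊗ C`. -/
abbrev Pow (n : ℕ) : Type (max u v) := ⨂[R] _ : Fin n, C.carrier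

/-- The degree `m` part of the tensor power. -/
def powGr (n : ℕ) (m : ℤ) : Submodule R (C.Pow n) :=
  Submodule.span R
    {t | ∃ (x : Fin n → C.carrier) (q : Fin n → ℤ),
      (∀ i, x i ∈ C.gr (q i)) ∧ ∑ i, q i = m ∧ t = PiTensorProduct.tprod R x}

/-- The sign involution `t ↦ (-1) ^ deg t • t` of the tensor power. -/
noncomputable def powSign (n : ℕ) : C.Pow n →ₗ[R] C.Pow n :=
  PiTensorProduct.map fun _ => signInv C.internal

/-- The differential of the tensor power, with Koszul signs:
`d (x₁ ⊗ ⋯ ⊗ xₙ) = ∑ᵢ (-1) ^ (deg x₁ + ⋯ + deg xᵢ₋₁) x₁ ⊗ ⋯ ⊗ d xᵢ ⊗ ⋯ ⊗ xₙ`. -/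
noncomputable def powD (n : ℕ) : C.Pow n →ₗ[R] C.Pow n :=
  ∑ i : Fin n, PiTensorProduct.map fun j =>
    if j < i then signInv C.internal else if j = i then C.d else LinearMap.id

/-- The projection of the tensor power onto the part of parity `e`. -/
noncomputable def powParity (n : ℕ) (e : Fin 2) : C.Pow n →ₗ[R] C.Pow n :=
  ∑ ε : Fin n → Fin 2, if (∑ i, par ε i) % 2 = ((e : ℕ) : ℤ) then
    PiTensorProduct.map (fun i => parityProj C.internal (ε i)) else 0

/-- The permutation of tensor factors that moves factor `i` to position `e i`, with Koszul
signs. -/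
noncomputable def powPerm {a b : ℕ} (e : Fin a ≃ Fin b) : C.Pow a →ₗ[R] C.Pow b :=
  ∑ ε : Fin a → Fin 2, permSign e (par ε) •
    ((PiTensorProduct.reindex R (fun _ => C.carrier) e).toLinearMap ∘ₗ
      PiTensorProduct.map (fun i => parityProj C.internal (ε i)))

end DGModule

/-! ### Operads -/

section Blocks

/-- The permutation of blocks induced by `e`: the block of `k (e i)` letters in position `i` is
moved to position `e i`, without changing the order inside the block. -/
def blockEquiv {a b : ℕ} (e : Fin a ≃ Fin b) (k : Fin b → ℕ) :
    Fin (∑ i, k (e i)) ≃ Fin (∑ i, k i) :=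
  finSigmaFinEquiv.symm.trans
    ((Equiv.sigmaCongrLeft (β := fun i => Fin (k i)) e).trans finSigmaFinEquiv)

/-- The block sum of bijections. -/
def sumEquiv {n : ℕ} {k l : Fin n → ℕ} (e : ∀ i, Fin (k i) ≃ Fin (l i)) :
    Fin (∑ i, k i) ≃ Fin (∑ i, l i) :=
  finSigmaFinEquiv.symm.trans ((Equiv.sigmaCongrRight e).trans finSigmaFinEquiv)

/-- The sizes `m` of the inner blocks of the `i`-th outer block. -/
def innerArity {n : ℕ} {k : Fin n → ℕ} (m : Fin (∑ i, k i) → ℕ) (i : Fin n) (j : Fin (k i)) : ℕ :=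
  m (finSigmaFinEquiv ⟨i, j⟩)

theorem sum_innerArity {n : ℕ} {k : Fin n → ℕ} (m : Fin (∑ i, k i) → ℕ) :
    ∑ l, m l = ∑ i, ∑ j, innerArity m i j := by
  rw [← finSigmaFinEquiv.sum_comp, Fintype.sum_sigma]
  rfl

theorem sum_fin_one (n : ℕ) : ∑ _i : Fin 1, n = n := by simp

theorem sum_one (n : ℕ) : ∑ _i : Fin n, 1 = n := by simp

end Blocks

/-- The data of a (symmetric, differential graded) operad, without its laws.

`comp k` is the structure map `γ : V(n) ⊗ V(k₁) ⊗ ⋯ ⊗ V(kₙ) → V(k₁ + ⋯ + kₙ)`.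

A bijection `Fin a ≃ Fin b` exists only for `a = b`, so that `act` is nothing but the right action
of the symmetric group `Perm (Fin n)` on each `V(n)`; letting it accept all bijections
`Fin a ≃ Fin b` avoids transports along equalities of arities. -/
structure OperadData (R : Type u) [CommRing R] where
  obj : ℕ → Type v
  [addCommGroup : ∀ n, AddCommGroup (obj n)]
  [module : ∀ n, Module R (obj n)]
  gr : ∀ n, ℤ → Submodule R (obj n)
  d : ∀ n, obj n →ₗ[R] obj n
  act : ∀ {a b : ℕ}, (Fin a ≃ Fin b) → (obj b →ₗ[R] obj a)
  one : obj 1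
  comp : ∀ {n : ℕ} (k : Fin n → ℕ),
    obj n →ₗ[R] MultilinearMap R (fun i => obj (k i)) (obj (∑ i, k i))

attribute [instance] OperadData.addCommGroup OperadData.module

/-- A symmetric operad in unbounded chain complexes of `R`-modules: each `V(n)` is a chain complex
with an action of the symmetric group by chain maps, the unit is a cycle of degree 0, and the
compositions are chain maps of degree 0 that satisfy the unit, associativity and equivariance
laws, with the signs of the Koszul convention. -/
structure Operad (R : Type u) [CommRing R] extends OperadData.{u, v} R where
  internal : ∀ n, DirectSum.IsInternal (gr n)
  d_mem : ∀ n k, ∀ x ∈ gr n k, d n x ∈ gr n (k - 1)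
  d_d : ∀ n x, d n (d n x) = 0
  act_mem : ∀ {a b : ℕ} (e : Fin a ≃ Fin b) (k : ℤ), ∀ x ∈ gr b k, act e x ∈ gr a k
  act_d : ∀ {a b : ℕ} (e : Fin a ≃ Fin b) (x : obj b), act e (d b x) = d a (act e x)
  act_refl : ∀ {a : ℕ} (x : obj a), act (Equiv.refl (Fin a)) x = x
  act_trans : ∀ {a b c : ℕ} (e : Fin a ≃ Fin b) (f : Fin b ≃ Fin c) (x : obj c),
    act (e.trans f) x = act e (act f x)
  one_mem : one ∈ gr 1 0
  d_one : d 1 one = 0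
  comp_mem : ∀ {n : ℕ} (k : Fin n → ℕ) (p : ℤ) (q : Fin n → ℤ) (x : obj n) (y : ∀ i, obj (k i)),
    x ∈ gr n p → (∀ i, y i ∈ gr (k i) (q i)) → comp k x y ∈ gr (∑ i, k i) (p + ∑ i, q i)
  d_comp : ∀ {n : ℕ} (k : Fin n → ℕ) (p : ℤ) (q : Fin n → ℤ) (x : obj n) (y : ∀ i, obj (k i)),
    x ∈ gr n p → (∀ i, y i ∈ gr (k i) (q i)) →
    d _ (comp k x y) = comp k (d n x) y +
      ∑ i, (p + ∑ j, if j < i then q j else 0).negOnePow •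
        comp k x (Function.update y i (d (k i) (y i)))
  one_comp : ∀ {n : ℕ} (x : obj n),
    comp (fun _ : Fin 1 => n) one (fun _ => x) = act (finCongr (sum_fin_one n)) x
  comp_one : ∀ {n : ℕ} (x : obj n),
    comp (fun _ : Fin n => 1) x (fun _ => one) = act (finCongr (sum_one n)) x
  comp_comp : ∀ {n : ℕ} (k : Fin n → ℕ) (m : Fin (∑ i, k i) → ℕ)
    (q : Fin n → ℤ) (r : Fin (∑ i, k i) → ℤ)
    (x : obj n) (y : ∀ i, obj (k i)) (z : ∀ l, obj (m l)),
    (∀ i, y i ∈ gr (k i) (q i)) → (∀ l, z l ∈ gr (m l) (r l)) →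
    comp m (comp k x y) z =
      (∑ i, ∑ l, if (finSigmaFinEquiv.symm l).1 < i then q i * r l else 0).negOnePow •
        act (finCongr (sum_innerArity m))
          (comp (fun i => ∑ j, innerArity m i j) x
            (fun i => comp (innerArity m i) (y i) (fun j => z (finSigmaFinEquiv ⟨i, j⟩))))
  act_comp : ∀ {a b : ℕ} (e : Fin a ≃ Fin b) (k : Fin b → ℕ) (q : Fin b → ℤ)
    (x : obj b) (y : ∀ i, obj (k i)), (∀ i, y i ∈ gr (k i) (q i)) →
    comp (fun i => k (e i)) (act e x) (fun i => y (e i)) =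
      permSign e (fun i => q (e i)) • act (blockEquiv e k) (comp k x y)
  comp_act : ∀ {n : ℕ} {k l : Fin n → ℕ} (e : ∀ i, Fin (k i) ≃ Fin (l i))
    (x : obj n) (y : ∀ i, obj (l i)),
    comp k x (fun i => act (e i) (y i)) = act (sumEquiv e) (comp l x y)

/-- A morphism of operads: chain maps of degree 0 in each arity, compatible with the actions of the
symmetric groups, the units and the compositions. -/
structure OperadHom {R : Type u} [CommRing R] (V : OperadData.{u, v} R)
    (W : OperadData.{u, w} R) where
  app : ∀ n, V.obj n →ₗ[R] W.obj n
  app_mem : ∀ n k, ∀ x ∈ V.gr n k, app n x ∈ W.gr n k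
  app_d : ∀ n x, app n (V.d n x) = W.d n (app n x)
  app_act : ∀ {a b : ℕ} (e : Fin a ≃ Fin b) (x : V.obj b), app a (V.act e x) = W.act e (app b x)
  app_one : app 1 V.one = W.one
  app_comp : ∀ {n : ℕ} (k : Fin n → ℕ) (x : V.obj n) (y : ∀ i, V.obj (k i)),
    app _ (V.comp k x y) = W.comp k (app n x) (fun i => app (k i) (y i))

/-! ### The Barratt-Eccles operad -/

namespace BarrattEccles

/-- The nondegenerate simplices `(w₀, …, w_k)` of the simplicial set with `k`-simplices
`(S_n)^(k+1)`, the universal cover of `K(S_n, 1)`; the first entry is the dimension. -/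
def Simplex (n : ℕ) : Type :=
  (k : ℕ) × {w : Fin (k + 1) → Equiv.Perm (Fin n) // ∀ i : Fin k, w i.castSucc ≠ w i.succ}

variable (R : Type u) [CommRing R]

open Classical in
/-- The class of a simplex in the normalized chains: degenerate simplices are zero. -/
noncomputable def cell {n k : ℕ} (w : Fin (k + 1) → Equiv.Perm (Fin n)) : Simplex n →₀ R :=
  if h : ∀ i : Fin k, w i.castSucc ≠ w i.succ then Finsupp.single ⟨k, w, h⟩ 1 else 0

/-- The degree `k` normalized chains. -/
def gr (n : ℕ) (k : ℤ) : Submodule R (Simplex n →₀ R) :=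
  Finsupp.supported R R {s | (s.1 : ℤ) = k}

/-- The alternating sum of the faces of a simplex. -/
noncomputable def boundary {n : ℕ} : Simplex n → (Simplex n →₀ R)
  | ⟨0, _⟩ => 0
  | ⟨k + 1, w⟩ => ∑ i : Fin (k + 2), (-1 : ℤ) ^ (i : ℕ) • cell R (fun t => w.1 (i.succAbove t))

/-- The right action of `S_n` by `w ↦ w σ` (transported along `a = b`). -/
def permAct {a b : ℕ} (e : Fin a ≃ Fin b) (w : Equiv.Perm (Fin b)) : Equiv.Perm (Fin a) :=
  e.trans (w.trans (finCongr (Fin.equiv_iff_eq.mp ⟨e⟩).symm))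

/-- Composition of permutations: `vᵢ` permutes the letters of the `i`-th block, and `w` permutes
the blocks. -/
def permComp {n : ℕ} {k : Fin n → ℕ} (w : Equiv.Perm (Fin n))
    (v : ∀ i, Equiv.Perm (Fin (k i))) : Equiv.Perm (Fin (∑ i, k i)) :=
  (sumEquiv v).trans ((blockEquiv w.symm k).symm.trans (finCongr (Equiv.sum_comp w.symm k)))

/-- The dimensions of a simplex and of a family of simplices, in one list. -/
def dims {n : ℕ} {k : Fin n → ℕ} (w : Simplex n) (v : ∀ i, Simplex (k i)) : Fin (n + 1) → ℕ :=
  Fin.cons w.1 (fun i => (v i).1)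

/-- The lattice paths from the origin to the point with coordinates `D`, given by the directions
of their unit steps. -/
def paths {r : ℕ} (D : Fin r → ℕ) : Finset (Fin (∑ j, D j) → Fin r) :=
  Finset.univ.filter fun a => ∀ j, (Finset.univ.filter fun t => a t = j).card = D j

/-- The `j`-th coordinate of a lattice path after `t` steps. -/
def coord {r N : ℕ} (a : Fin N → Fin r) (j : Fin r) (t : ℕ) : ℕ :=
  (Finset.univ.filter fun t' : Fin N => (t' : ℕ) < t ∧ a t' = j).card

/-- The number of inversions of the sequence of directions of a lattice path. -/
def inversions {r N : ℕ} (a : Fin N → Fin r) : ℕ :=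
  (Finset.univ.filter fun t : Fin N × Fin N => t.1 < t.2 ∧ a t.2 < a t.1).card

/-- The composition of simplices: the Eilenberg-Zilber shuffle product of `w, v₁, …, vₙ`, which
is the signed sum over all lattice paths, followed by the composition of permutations in each
vertex. -/
noncomputable def simplexComp {n : ℕ} {k : Fin n → ℕ} (w : Simplex n) (v : ∀ i, Simplex (k i)) :
    Simplex (∑ i, k i) →₀ R :=
  ∑ a ∈ paths (dims w v), (-1 : ℤ) ^ inversions a •
    cell R (fun t : Fin ((∑ j, dims w v j) + 1) =>
      permComp (w.2.1 (Fin.ofNat _ (coord a 0 t)))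
        (fun i => (v i).2.1 (Fin.ofNat _ (coord a i.succ t))))

open Classical in
/-- The Barratt-Eccles operad over `R`: the normalized chains of the universal covers of the spaces
`K(S_n, 1)`. -/
noncomputable def operad : OperadData.{u, u} R where
  obj n := Simplex n →₀ R
  gr n := gr R n
  d n := Finsupp.linearCombination R (boundary R)
  act e := Finsupp.linearCombination R (fun s => cell R (fun t => permAct e (s.2.1 t)))
  one := cell R (fun _ : Fin 1 => Equiv.refl (Fin 1))
  comp k := Finsupp.linearCombination R (fun w =>
    ((Finsupp.linearCombination R (fun v : ∀ i, Simplex (k i) => simplexComp R w v)) ∘ₗ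
      (PiTensorProduct.ofFinsuppEquiv' (R := R)).toLinearMap).compMultilinearMap
        (PiTensorProduct.tprod R))

theorem internal (n : ℕ) : DirectSum.IsInternal ((operad R).gr n) := by
  rw [DirectSum.isInternal_submodule_iff_iSupIndep_and_iSup_eq_top]
  constructor
  · intro k
    have : (⨆ j, ⨆ (_ : j ≠ k), (operad R).gr n j) ≤
        Finsupp.supported R R {s : Simplex n | (s.1 : ℤ) ≠ k} :=
      iSup₂_le fun j hj => Finsupp.supported_mono (by rintro s rfl; exact hj)
    refine Disjoint.mono_right this ?_
    refine Finsupp.disjoint_supported_supported ?_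
    rw [Set.disjoint_left]
    intro s hs hs'
    exact hs' hs
  · change (⨆ k : ℤ, Finsupp.supported R R {s : Simplex n | (s.1 : ℤ) = k}) = ⊤
    rw [← Finsupp.supported_iUnion, ← Finsupp.supported_univ]
    congr 1
    ext s
    simp

/-- The augmentation of the Barratt-Eccles operad, which sends each vertex to `1`. -/
noncomputable def augmentation (n : ℕ) : (operad R).obj n →ₗ[R] R :=
  Finsupp.linearCombination R (fun s : Simplex n => if s.1 = 0 then (1 : R) else 0)

end BarrattEccles

/-! ### Tensor products of operads -/

section Hadamard

variable {R : Type u} [CommRing R] (V : OperadData.{u, v} R) (W : OperadData.{u, w} R)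

/-- The composition of the tensor product of two operads without signs:
`(x ⊗ a; y₁ ⊗ b₁, …, yₙ ⊗ bₙ) ↦ γ(x; y₁, …, yₙ) ⊗ γ(a; b₁, …, bₙ)`. -/
noncomputable def tensorCompUnsigned {n : ℕ} (k : Fin n → ℕ) :
    (V.obj n ⊗[R] W.obj n) →ₗ[R]
      MultilinearMap R (fun i => V.obj (k i) ⊗[R] W.obj (k i))
        (V.obj (∑ i, k i) ⊗[R] W.obj (∑ i, k i)) :=
  TensorProduct.lift (LinearMap.mk₂ R
    (fun x a =>
      (TensorProduct.map (PiTensorProduct.lift (V.comp k x))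
        (PiTensorProduct.lift (W.comp k a))).compMultilinearMap
          (interchange (fun i => V.obj (k i)) (fun i => W.obj (k i))))
    (by intro x x' a; ext y; simp [TensorProduct.map_add_left])
    (by intro c x a; ext y; simp [TensorProduct.map_smul_left])
    (by intro x a a'; ext y; simp [TensorProduct.map_add_right])
    (by intro c x a; ext y; simp [TensorProduct.map_smul_right]))

theorem tensorCompUnsigned_tmul {n : ℕ} (k : Fin n → ℕ) (x : V.obj n) (a : W.obj n)
    (y : ∀ i, V.obj (k i)) (b : ∀ i, W.obj (k i)) :
    tensorCompUnsigned V W k (x ⊗ₜ a) (fun i => y i ⊗ₜ b i) =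
      V.comp k x y ⊗ₜ W.comp k a b := by
  simp [tensorCompUnsigned, interchange_tmul]

variable (hV : ∀ n, DirectSum.IsInternal (V.gr n)) (hW : ∀ n, DirectSum.IsInternal (W.gr n))

/-- The projection of `V(n) ⊗ W(n)` onto the part of bi-parity `(e, e')`. -/
noncomputable def biparity (n : ℕ) (e e' : Fin 2) :
    (V.obj n ⊗[R] W.obj n) →ₗ[R] (V.obj n ⊗[R] W.obj n) :=
  TensorProduct.map (parityProj (hV n) e) (parityProj (hW n) e')

/-- The tensor product of operads, `(V ⊗ W)(n) = V(n) ⊗ W(n)`, with the diagonal actions and the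
compositions of both factors. The sign in the composition of `x ⊗ a` with the `yᵢ ⊗ bᵢ` is the
Koszul sign of the rearrangement of `x a y₁ b₁ ⋯ yₙ bₙ` into `x y₁ ⋯ yₙ a b₁ ⋯ bₙ`. -/
noncomputable def tensorOperad : OperadData.{u, max v w} R where
  obj n := V.obj n ⊗[R] W.obj n
  gr n m := ⨆ p : ℤ, LinearMap.range
    (TensorProduct.map (V.gr n p).subtype (W.gr n (m - p)).subtype)
  d n := TensorProduct.map (V.d n) LinearMap.id + TensorProduct.map (signInv (hV n)) (W.d n)
  act e := TensorProduct.map (V.act e) (W.act e)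
  one := V.one ⊗ₜ[R] W.one
  comp {n} k :=
    ∑ ex : Fin 2, ∑ ea : Fin 2, ∑ ey : Fin n → Fin 2, ∑ eb : Fin n → Fin 2,
      ((∑ i, ((ea : ℕ) : ℤ) * par ey i) +
          ∑ i, ∑ j, if i < j then par eb i * par ey j else 0).negOnePow •
        (MultilinearMap.compLinearMapₗ
            (fun i => biparity V W hV hW (k i) (ey i) (eb i)) ∘ₗ
          tensorCompUnsigned V W k ∘ₗ biparity V W hV hW n ex ea)

end Hadamard

/-! ### Coalgebras over an operad -/

section Coalgebra

variable {R : Type u} [CommRing R]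

/-- The map `Hom(C, C^{⊗k₁}) ⊗ ⋯ ⊗ Hom(C, C^{⊗kₙ}) → Hom(C^{⊗n}, C^{⊗(k₁+⋯+kₙ)})` that enters
the compositions of the coendomorphism operad: up to sign `(g₁, …, gₙ) ↦ g₁ ⊗ ⋯ ⊗ gₙ`. The
summand of index `u, v` is the part of parity `u i` in the `i`-th input and of parity `v i` in the
`i`-th output; the sign is explained at `coEnd`. -/
noncomputable def coEndTensor (C : DGModule.{u, v} R) {n : ℕ} (k : Fin n → ℕ) :
    MultilinearMap R (fun i => C.carrier →ₗ[R] C.Pow (k i)) (C.Pow n →ₗ[R] C.Pow (∑ i, k i)) :=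
  ∑ u : Fin n → Fin 2, ∑ v : Fin n → Fin 2,
    (∑ i, ∑ j, if i < j then (par u j + par v j) * par v i else 0).negOnePow •
      (LinearMap.llcomp R _ _ _ (flatten C.carrier k)).compMultilinearMap
        ((PiTensorProduct.mapMultilinear R (fun _ => C.carrier) (fun i => C.Pow (k i))).compLinearMap
          (fun i => LinearMap.llcomp R _ _ _ (C.powParity (k i) (v i)) ∘ₗ
            LinearMap.lcomp R _ (parityProj C.internal (u i))))

/-- The coendomorphism operad of a chain complex `C`, `CoEnd(C)(n) = Hom_R(C, C^{⊗n})`. The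
differential is `d f = f ∘ d - (-1) ^ deg f • d ∘ f`; note that `(-1) ^ deg f • f` is the
conjugate of `f` by the sign involutions. The symmetric groups act by permutation of the factors of
`C^{⊗n}`. The composition of `f` with `g₁, …, gₙ` is `(g₁ ⊗ ⋯ ⊗ gₙ) ∘ f`, with the Koszul sign
`(-1) ^ ∑_{i<j} deg gⱼ * deg xᵢ` in the value of `g₁ ⊗ ⋯ ⊗ gₙ` at `x₁ ⊗ ⋯ ⊗ xₙ`, and with the sign
`(-1) ^ ∑_{i<j} deg gᵢ * deg gⱼ` which makes the composition a chain map for the differential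
above; since `deg gᵢ xᵢ = deg gᵢ + deg xᵢ`, the two signs combine to
`(-1) ^ ∑_{i<j} deg gⱼ * deg gᵢ xᵢ`. -/
noncomputable def coEnd (C : DGModule.{u, v} R) : OperadData.{u, max u v} R where
  obj n := C.carrier →ₗ[R] C.Pow n
  gr n k := ⨅ j : ℤ, Submodule.compatibleMaps (C.gr j) (C.powGr n (j + k))
  d n :=
    { toFun := fun f => f ∘ₗ C.d - C.powD n ∘ₗ (C.powSign n ∘ₗ f ∘ₗ signInv C.internal)
      map_add' := by intro f g; ext x; simp; abel
      map_smul' := by intro c f; ext x; simp [smul_sub] }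
  act e := LinearMap.llcomp R _ _ _ (C.powPerm e.symm)
  one := (PiTensorProduct.subsingletonEquiv (s := fun _ => C.carrier) (0 : Fin 1)).symm.toLinearMap
  comp k :=
    { toFun := fun f => (LinearMap.lcomp R _ f).compMultilinearMap (coEndTensor C k)
      map_add' := by intro f f'; ext g x; simp
      map_smul' := by intro c f; ext g x; simp }

/-- The symmetric group `S_n` acting from the left on `V(n)`, by inverting the right action. -/
def Operad.rep (V : Operad.{u, v} R) (n : ℕ) : Representation R (Equiv.Perm (Fin n)) (V.obj n) where
  toFun σ := V.act σ⁻¹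
  map_one' := LinearMap.ext fun x => V.act_refl x
  map_mul' σ τ := LinearMap.ext fun x => by
    rw [mul_inv_rev]
    exact V.act_trans σ⁻¹ τ⁻¹ x

/-- The standing condition on an operad `V`:
* there is a morphism of operads `δ : V → V ⊗ 𝔖` to the tensor product of `V` with the
  Barratt-Eccles operad whose composite with the projection `V ⊗ 𝔖 → V` given by the augmentation
  of `𝔖` is the identity;
* each `V(n)` is `R S_n`-projective and of finite type (finitely generated in each degree);
* `V(1)` is equal to `R`, generated by the unit. -/
structure Operad.Admissible (V : Operad.{u, v} R) : Prop where
  exists_diagonal : ∃ δ : OperadHom V.toOperadData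
      (tensorOperad V.toOperadData (BarrattEccles.operad R) V.internal (BarrattEccles.internal R)),
    ∀ n x, TensorProduct.rid R (V.obj n)
      (LinearMap.lTensor (V.obj n) (BarrattEccles.augmentation R n) (δ.app n x)) = x
  projective : ∀ n, Module.Projective (MonoidAlgebra R (Equiv.Perm (Fin n))) (V.rep n).asModule
  finite_type : ∀ n k, (V.gr n k).FG
  arity_one : Function.Bijective (fun r : R => r • V.one)

/-- A coalgebra over the operad `V`: a chain complex `C` with a morphism of operads
`V → CoEnd(C)`. -/
structure Coalgebra (V : Operad.{u, v} R) where
  cx : DGModule.{u, w} R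
  str : OperadHom V.toOperadData (coEnd cx)

/-- The structure map `C → C^{⊗n}` given by an element of `V(n)`. -/
def Coalgebra.cop {V : Operad.{u, v} R} (C : Coalgebra.{u, v, w} V) (n : ℕ) :
    V.obj n →ₗ[R] (C.cx.carrier →ₗ[R] C.cx.Pow n) :=
  C.str.app n

/-- Morphisms of `V`-coalgebras: chain maps of degree 0 that commute with all structure maps
`C → C^{⊗n}`. -/
structure IsCoalgebraHom {V : Operad.{u, v} R} (C : Coalgebra.{u, v, w} V)
    (D : Coalgebra.{u, v, u'} V) (f : C.cx.carrier →ₗ[R] D.cx.carrier) : Prop where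
  map_mem : ∀ k, ∀ x ∈ C.cx.gr k, f x ∈ D.cx.gr k
  map_d : ∀ x, f (C.cx.d x) = D.cx.d (f x)
  map_str : ∀ n (v : V.obj n) (x : C.cx.carrier),
    PiTensorProduct.map (fun _ => f) (C.cop n v x) = D.cop n v (f x)

/-- A subcomplex of a chain complex: a graded submodule that is closed under the differential. -/
structure Subcomplex (C : DGModule.{u, v} R) where
  toSubmodule : Submodule R C.carrier
  graded : toSubmodule ≤ ⨆ k, toSubmodule ⊓ C.gr k
  d_mem : ∀ x ∈ toSubmodule, C.d x ∈ toSubmodule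

/-- A subcomplex as a chain complex. -/
def Subcomplex.toDGModule {C : DGModule.{u, v} R} (D : Subcomplex C) : DGModule.{u, v} R where
  carrier := D.toSubmodule
  gr k := (C.gr k).comap D.toSubmodule.subtype
  internal := by
    have hC := (DirectSum.isInternal_submodule_iff_iSupIndep_and_iSup_eq_top _).1 C.internal
    refine (DirectSum.isInternal_submodule_iff_iSupIndep_and_iSup_eq_top _).2 ⟨?_, ?_⟩
    · intro k
      rw [Submodule.disjoint_def]
      intro x hx hx'
      have h1 := Submodule.mem_map_of_mem (f := D.toSubmodule.subtype) hx'
      have h2 : (⨆ j, ⨆ (_ : j ≠ k), (C.gr j).comap D.toSubmodule.subtype).map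
          D.toSubmodule.subtype ≤ ⨆ j, ⨆ (_ : j ≠ k), C.gr j := by
        simp only [Submodule.map_iSup]
        exact iSup₂_mono fun j _ => Submodule.map_comap_le _ _
      exact Subtype.ext (Submodule.disjoint_def.1 (hC.1 k) _ hx (h2 h1))
    · refine Submodule.map_injective_of_injective D.toSubmodule.injective_subtype ?_
      simp only [Submodule.map_iSup, Submodule.map_comap_subtype, Submodule.map_subtype_top]
      exact le_antisymm (iSup_le fun k => inf_le_left) D.graded
  d := C.d.restrict D.d_mem
  d_mem k x hx := C.d_mem k x hx
  d_d x := Subtype.ext (C.d_d x)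

/-- A sub-coalgebra of `C`: a subcomplex with the structure of a `V`-coalgebra for which the
inclusion is a morphism of coalgebras. -/
structure SubCoalgebra {V : Operad.{u, v} R} (C : Coalgebra.{u, v, w} V) where
  sub : Subcomplex C.cx
  str : OperadHom V.toOperadData (coEnd sub.toDGModule)
  incl : IsCoalgebraHom ⟨sub.toDGModule, str⟩ C sub.toSubmodule.subtype

/-- A sub-coalgebra as a coalgebra. -/
def SubCoalgebra.toCoalgebra {V : Operad.{u, v} R} {C : Coalgebra.{u, v, w} V}
    (A : SubCoalgebra C) : Coalgebra.{u, v, w} V :=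
  ⟨A.sub.toDGModule, A.str⟩

/-- The underlying submodule of a sub-coalgebra. -/
def SubCoalgebra.toSubmodule {V : Operad.{u, v} R} {C : Coalgebra.{u, v, w} V}
    (A : SubCoalgebra C) : Submodule R C.cx.carrier :=
  A.sub.toSubmodule

/-- A module is nearly free if every countable submodule is free. -/
def NearlyFree (R : Type u) [CommRing R] (M : Type v) [AddCommGroup M] [Module R M] : Prop :=
  ∀ N : Submodule R M, Countable N → Module.Free R N

end Coalgebra

end DGOperad

/-! The proof is a countable closure argument. Each `V(n)` is countable, being a direct sum over ℤ
of finitely generated modules over a countable ring. A tensor `C.cop n v x` is a finite sum of pure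
tensors, so only finitely many elements of `C` occur in it. A countable set can therefore be
enlarged ω times by differentials, homogeneous components and such tensor factors. The union is a
countable subcomplex `S` whose coproducts lie in the image of the powers of `S`
(`exists_countable_submodule_closed`, `exists_countable_subCoalgebra`).

To turn this into a coalgebra structure, the coproducts must lift to `S^{⊗n}`, for which `S^{⊗n} →
C^{⊗n}` has to be injective. A nearly free module over a countable domain is torsion-free, because
its cyclic submodules are countable, hence free. Over a principal ideal domain torsion-free means
flat, and tensor powers of an injection of flat modules are injective
(`NearlyFree.powMap_injective`). The lift is then unique, and every axiom of an operad morphism can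
be checked after mapping to `C`, since the inclusion intertwines all operations of the
coendomorphism operads. The degree axiom also needs that the degree of a tensor is detected in
`C^{⊗n}` (`powMap_mem_powGr_iff`). This is `exists_subCoalgebra`.

Applied to singletons and to unions of two countable sub-coalgebras, the closure argument gives
covering and directedness. Compatible maps glue linearly, and being a coalgebra morphism is tested
at one element at a time, inside a sub-coalgebra that contains it. -/

namespace DGOperad

variable {R : Type u} [CommRing R]

/-! ### Tensor powers of flat modules -/

section Flat

/-- Splitting off the last factor of a tensor power. -/
noncomputable def powSuccEquiv (P : Type v) [AddCommGroup P] [Module R P] (n : ℕ) :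
    (⨂[R] _ : Fin (n + 1), P) ≃ₗ[R] (⨂[R] _ : Fin n, P) ⊗[R] P :=
  (PiTensorProduct.reindex R (fun _ => P) finSumFinEquiv.symm).trans
    ((PiTensorProduct.tmulEquiv R P).symm.trans
      (LinearEquiv.lTensor _ (PiTensorProduct.subsingletonEquiv (0 : Fin 1))))

/-- Flatness of the powers is carried through the induction because a tensor product of two
injections is known to be injective only under flatness of the factors. -/
theorem pow_flat_and_map_injective {M : Type v} {N : Type w} [AddCommGroup M] [Module R M]
    [AddCommGroup N] [Module R N] [Module.Flat R M] [Module.Flat R N] (f : M →ₗ[R] N)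
    (hf : Function.Injective f) (n : ℕ) :
    Module.Flat R (⨂[R] _ : Fin n, M) ∧ Module.Flat R (⨂[R] _ : Fin n, N) ∧
      Function.Injective (PiTensorProduct.map (R := R) (fun _ : Fin n => f)) := by
  induction n with
  | zero =>
    refine ⟨Module.Flat.of_linearEquiv (PiTensorProduct.isEmptyEquiv (Fin 0)),
      Module.Flat.of_linearEquiv (PiTensorProduct.isEmptyEquiv (Fin 0)), ?_⟩
    -- Both empty tensor powers are `R`, and the induced map is the identity of `R`.
    have : (PiTensorProduct.isEmptyEquiv (Fin 0)).toLinearMap ∘ₗ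
        PiTensorProduct.map (R := R) (fun _ : Fin 0 => f) =
        (PiTensorProduct.isEmptyEquiv (Fin 0)).toLinearMap := by
      ext x
      simp
    refine Function.Injective.of_comp
      (f := (PiTensorProduct.isEmptyEquiv (R := R) (s := fun _ => N) (Fin 0))) ?_
    have h2 := congrArg DFunLike.coe this
    rw [LinearMap.coe_comp] at h2
    exact h2 ▸ (PiTensorProduct.isEmptyEquiv (R := R) (s := fun _ => M) (Fin 0)).injective
  | succ n ih =>
    obtain ⟨hM, hN, hi⟩ := ih
    have key : (powSuccEquiv N n).toLinearMap ∘ₗ PiTensorProduct.map (R := R) (fun _ : Fin (n + 1) => f) =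
        TensorProduct.map (PiTensorProduct.map (fun _ : Fin n => f)) f ∘ₗ (powSuccEquiv M n).toLinearMap := by
      ext x
      simp [powSuccEquiv, PiTensorProduct.reindex_tprod]
    refine ⟨Module.Flat.of_linearEquiv (powSuccEquiv M n), Module.Flat.of_linearEquiv (powSuccEquiv N n), ?_⟩
    refine Function.Injective.of_comp (f := powSuccEquiv (R := R) N n) ?_
    have h2 := congrArg DFunLike.coe key
    rw [LinearMap.coe_comp, LinearMap.coe_comp] at h2
    exact h2 ▸ (TensorProduct.map_injective_of_flat_flat' _ _ hi hf).comp (powSuccEquiv M n).injective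

end Flat

/-! ### Homogeneous components and parity -/

section Graded

variable {M : Type v} [AddCommGroup M] [Module R M] {N : Type w} [AddCommGroup N] [Module R N]

theorem ext_of_internal {gr : ℤ → Submodule R M} (h : DirectSum.IsInternal gr)
    {f g : M →ₗ[R] N} (hfg : ∀ k, ∀ x ∈ gr k, f x = g x) : f = g := by
  refine LinearMap.ext fun x => ?_
  have hx : x ∈ ⨆ k, gr k := by
    rw [((DirectSum.isInternal_submodule_iff_iSupIndep_and_iSup_eq_top _).1 h).2]; trivial
  induction hx using Submodule.iSup_induction' with
  | mem k x hx => exact hfg k x hx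
  | zero => simp
  | add x y _ _ hx hy => simp [hx, hy]

theorem ofBijective_coeLinearMap_symm_apply {gr : ℤ → Submodule R M}
    (h : DirectSum.IsInternal gr) {k : ℤ} {x : M} (hx : x ∈ gr k) :
    (LinearEquiv.ofBijective (DirectSum.coeLinearMap gr) h).symm x =
      DirectSum.lof R ℤ (fun k => gr k) k ⟨x, hx⟩ := by
  rw [LinearEquiv.symm_apply_eq]
  exact (DirectSum.coeLinearMap_lof gr k ⟨x, hx⟩).symm

theorem parityProj_of_mem {gr : ℤ → Submodule R M} (h : DirectSum.IsInternal gr) (e : Fin 2)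
    {k : ℤ} {x : M} (hx : x ∈ gr k) :
    parityProj h e x = if k % 2 = ((e : ℕ) : ℤ) then x else 0 := by
  rw [parityProj, LinearMap.comp_apply, LinearEquiv.coe_coe,
    ofBijective_coeLinearMap_symm_apply h hx, DirectSum.toModule_lof]
  split_ifs <;> rfl

/-- The projection of a `ℤ`-graded module onto its component of degree `k`. -/
noncomputable def degreeProj {gr : ℤ → Submodule R M} (h : DirectSum.IsInternal gr) (k : ℤ) :
    M →ₗ[R] M :=
  (gr k).subtype ∘ₗ DirectSum.component R ℤ (fun k => gr k) k ∘ₗ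
    (LinearEquiv.ofBijective (DirectSum.coeLinearMap gr) h).symm.toLinearMap

theorem degreeProj_mem {gr : ℤ → Submodule R M} (h : DirectSum.IsInternal gr) (k : ℤ) (x : M) :
    degreeProj h k x ∈ gr k :=
  Subtype.property _

theorem degreeProj_of_mem {gr : ℤ → Submodule R M} (h : DirectSum.IsInternal gr) (j : ℤ)
    {k : ℤ} {x : M} (hx : x ∈ gr k) :
    degreeProj h j x = if k = j then x else 0 := by
  rw [degreeProj, LinearMap.comp_apply, LinearMap.comp_apply, LinearEquiv.coe_coe,
    ofBijective_coeLinearMap_symm_apply h hx]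
  split_ifs with hk
  · subst hk
    rw [DirectSum.component.lof_self]
    rfl
  · rw [DirectSum.component.of, dif_neg hk]
    rfl

theorem exists_sum_degreeProj {gr : ℤ → Submodule R M} (h : DirectSum.IsInternal gr) (x : M) :
    ∃ s : Finset ℤ, ∑ k ∈ s, degreeProj h k x = x ∧ ∀ k ∉ s, degreeProj h k x = 0 := by
  classical
  set y := (LinearEquiv.ofBijective (DirectSum.coeLinearMap gr) h).symm x with hy
  refine ⟨DFinsupp.support y, ?_, fun k hk => ?_⟩
  · have h1 : DirectSum.coeLinearMap gr y = x :=
      (LinearEquiv.ofBijective (DirectSum.coeLinearMap gr) h).apply_symm_apply x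
    conv_rhs => rw [← h1, DirectSum.coeLinearMap_eq_dfinsuppSum, DFinsupp.sum]
    rfl
  · have : y k = 0 := by simpa using hk
    change ((y k : gr k) : M) = 0
    rw [this]; rfl

variable {gr : ℤ → Submodule R M} {gr' : ℤ → Submodule R N}

/-- All Koszul signs are encoded by parity projections, so this commutation is what makes the signed
constructions natural in degree-preserving maps. -/
theorem comp_parityProj (h : DirectSum.IsInternal gr) (h' : DirectSum.IsInternal gr')
    {f : M →ₗ[R] N} (hf : ∀ k, ∀ x ∈ gr k, f x ∈ gr' k) (e : Fin 2) :
    f ∘ₗ parityProj h e = parityProj h' e ∘ₗ f := by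
  refine ext_of_internal h fun k x hx => ?_
  simp only [LinearMap.comp_apply]
  rw [parityProj_of_mem h e hx, parityProj_of_mem h' e (hf k x hx)]
  split_ifs <;> simp

theorem comp_signInv (h : DirectSum.IsInternal gr) (h' : DirectSum.IsInternal gr')
    {f : M →ₗ[R] N} (hf : ∀ k, ∀ x ∈ gr k, f x ∈ gr' k) :
    f ∘ₗ signInv h = signInv h' ∘ₗ f := by
  rw [signInv, signInv, LinearMap.comp_sub, LinearMap.sub_comp, comp_parityProj h h' hf,
    comp_parityProj h h' hf]

theorem comp_degreeProj (h : DirectSum.IsInternal gr) (h' : DirectSum.IsInternal gr')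
    {f : M →ₗ[R] N} (hf : ∀ k, ∀ x ∈ gr k, f x ∈ gr' k) (j : ℤ) :
    f ∘ₗ degreeProj h j = degreeProj h' j ∘ₗ f := by
  refine ext_of_internal h fun k x hx => ?_
  simp only [LinearMap.comp_apply]
  rw [degreeProj_of_mem h j hx, degreeProj_of_mem h' j (hf k x hx)]
  split_ifs <;> simp

end Graded

/-! ### Naturality of the signed operations on tensor powers -/

section Naturality

theorem comp_finset_sum {M N P : Type*} [AddCommGroup M] [Module R M] [AddCommGroup N] [Module R N]
    [AddCommGroup P] [Module R P] {ι : Type*} (s : Finset ι) (f : N →ₗ[R] P) (g : ι → M →ₗ[R] N) :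
    f ∘ₗ ∑ i ∈ s, g i = ∑ i ∈ s, f ∘ₗ g i := by
  ext; simp

theorem finset_sum_comp {M N P : Type*} [AddCommGroup M] [Module R M] [AddCommGroup N] [Module R N]
    [AddCommGroup P] [Module R P] {ι : Type*} (s : Finset ι) (f : M →ₗ[R] N) (g : ι → N →ₗ[R] P) :
    (∑ i ∈ s, g i) ∘ₗ f = ∑ i ∈ s, g i ∘ₗ f := by
  ext; simp

variable {C : DGModule.{u, v} R} {D : DGModule.{u, w} R}

theorem map_comp_map_comm {ι : Type*} {M N : ι → Type*} {M' N' : ι → Type*}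
    [∀ i, AddCommGroup (M i)] [∀ i, Module R (M i)] [∀ i, AddCommGroup (N i)]
    [∀ i, Module R (N i)] [∀ i, AddCommGroup (M' i)] [∀ i, Module R (M' i)]
    [∀ i, AddCommGroup (N' i)] [∀ i, Module R (N' i)]
    {f : ∀ i, M i →ₗ[R] N i} {f' : ∀ i, M' i →ₗ[R] N' i}
    {g : ∀ i, M i →ₗ[R] M' i} {g' : ∀ i, N i →ₗ[R] N' i} (h : ∀ i, f' i ∘ₗ g i = g' i ∘ₗ f i) :
    PiTensorProduct.map f' ∘ₗ PiTensorProduct.map g =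
      PiTensorProduct.map g' ∘ₗ PiTensorProduct.map f := by
  rw [← PiTensorProduct.map_comp, ← PiTensorProduct.map_comp]
  exact congrArg _ (funext h)

/-- The `n`-th tensor power of a linear map. -/
noncomputable abbrev powMap (f : C.carrier →ₗ[R] D.carrier) (n : ℕ) : C.Pow n →ₗ[R] D.Pow n :=
  PiTensorProduct.map fun _ => f

variable {f : C.carrier →ₗ[R] D.carrier}

theorem powMap_comp_flatten (f : C.carrier →ₗ[R] D.carrier) {n : ℕ} (k : Fin n → ℕ) :
    powMap f (∑ i, k i) ∘ₗ flatten C.carrier k =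
      flatten D.carrier k ∘ₗ PiTensorProduct.map (fun i => powMap f (k i)) := by
  -- An iterated tensor product is spanned by tensors of pure tensors, the only elements on which
  -- `flatten` is computed.
  refine PiTensorProduct.ext_of_span_eq_top
    (g := fun i => (PiTensorProduct.tprod R : MultilinearMap R (fun _ : Fin (k i) => C.carrier) _))
    (fun i => PiTensorProduct.span_tprod_eq_top) fun x => ?_
  simp only [LinearMap.comp_apply, PiTensorProduct.map_tprod, flatten_tprod]

theorem powMap_comp_powD (hf : ∀ k, ∀ x ∈ C.gr k, f x ∈ D.gr k) (hd : f ∘ₗ C.d = D.d ∘ₗ f)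
    (n : ℕ) : powMap f n ∘ₗ C.powD n = D.powD n ∘ₗ powMap f n := by
  rw [DGModule.powD, DGModule.powD, comp_finset_sum, finset_sum_comp]
  refine Finset.sum_congr rfl fun i _ => map_comp_map_comm fun j => ?_
  split_ifs
  · exact comp_signInv _ _ hf
  · exact hd
  · rfl

theorem powMap_comp_powSign (hf : ∀ k, ∀ x ∈ C.gr k, f x ∈ D.gr k) (n : ℕ) :
    powMap f n ∘ₗ C.powSign n = D.powSign n ∘ₗ powMap f n :=
  map_comp_map_comm fun _ => comp_signInv _ _ hf

theorem powMap_comp_powParity (hf : ∀ k, ∀ x ∈ C.gr k, f x ∈ D.gr k) (n : ℕ) (e : Fin 2) :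
    powMap f n ∘ₗ C.powParity n e = D.powParity n e ∘ₗ powMap f n := by
  rw [DGModule.powParity, DGModule.powParity, comp_finset_sum, finset_sum_comp]
  refine Finset.sum_congr rfl fun i _ => ?_
  split_ifs
  · exact map_comp_map_comm fun _ => comp_parityProj _ _ hf _
  · simp

theorem powMap_comp_powPerm (hf : ∀ k, ∀ x ∈ C.gr k, f x ∈ D.gr k) {a b : ℕ}
    (e : Fin a ≃ Fin b) :
    powMap f b ∘ₗ C.powPerm e = D.powPerm e ∘ₗ powMap f a := by
  rw [DGModule.powPerm, DGModule.powPerm, comp_finset_sum, finset_sum_comp]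
  refine Finset.sum_congr rfl fun i _ => ?_
  have h := map_comp_map_comm (R := R)
    (fun j : Fin a => comp_parityProj C.internal D.internal hf (i j))
  have key : powMap f b ∘ₗ ((PiTensorProduct.reindex R (fun _ => C.carrier) e).toLinearMap ∘ₗ
        PiTensorProduct.map (fun j => parityProj C.internal (i j))) =
      ((PiTensorProduct.reindex R (fun _ => D.carrier) e).toLinearMap ∘ₗ
        PiTensorProduct.map (fun j => parityProj D.internal (i j))) ∘ₗ powMap f a := by
    rw [LinearMap.comp_assoc, ← h, ← LinearMap.comp_assoc, ← LinearMap.comp_assoc]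
    congr 1
    exact PiTensorProduct.map_comp_reindex_eq (fun _ => f) e
  -- `key` is the unsigned identity; the sign is the same on both sides and equals 1 or -1.
  rcases Int.units_eq_one_or (permSign e (par i)) with hs | hs
  · rw [hs, one_smul, one_smul, key]
  · rw [hs, Units.neg_smul, Units.neg_smul, one_smul, one_smul, LinearMap.comp_neg,
      LinearMap.neg_comp, key]

/-- The sign of each summand depends only on the parity indices, not on the complex. It thus
suffices to compare summands without signs, factor by factor. -/
theorem powMap_comp_coEndTensor (hf : ∀ k, ∀ x ∈ C.gr k, f x ∈ D.gr k) {n : ℕ} (k : Fin n → ℕ)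
    {g : ∀ i, C.carrier →ₗ[R] C.Pow (k i)} {g' : ∀ i, D.carrier →ₗ[R] D.Pow (k i)}
    (h : ∀ i, powMap f (k i) ∘ₗ g i = g' i ∘ₗ f) :
    powMap f _ ∘ₗ coEndTensor C k g = coEndTensor D k g' ∘ₗ powMap f n := by
  simp only [coEndTensor, sum_apply, comp_finset_sum, finset_sum_comp]
  refine Finset.sum_congr rfl fun a _ => Finset.sum_congr rfl fun b _ => ?_
  have key : powMap f _ ∘ₗ flatten C.carrier k ∘ₗ PiTensorProduct.map
      (fun i => C.powParity (k i) (b i) ∘ₗ g i ∘ₗ parityProj C.internal (a i)) =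
    (flatten D.carrier k ∘ₗ PiTensorProduct.map
      (fun i => D.powParity (k i) (b i) ∘ₗ g' i ∘ₗ parityProj D.internal (a i))) ∘ₗ powMap f n := by
    rw [← LinearMap.comp_assoc, powMap_comp_flatten, LinearMap.comp_assoc, LinearMap.comp_assoc]
    congr 1
    refine map_comp_map_comm fun i => ?_
    refine LinearMap.ext fun x => ?_
    have h1 := LinearMap.congr_fun (h i)
    have h2 := LinearMap.congr_fun (powMap_comp_powParity hf (k i) (b i))
    have h3 := LinearMap.congr_fun (comp_parityProj C.internal D.internal hf (a i))
    simp only [LinearMap.comp_apply] at h1 h2 h3 ⊢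
    rw [h2, h1, h3]
  -- The unit of ℤ acts through its integer value, so an arbitrary integer coefficient covers the
  -- sign.
  have hz : ∀ z : ℤ, powMap f _ ∘ₗ (z • (flatten C.carrier k ∘ₗ PiTensorProduct.map
      (fun i => C.powParity (k i) (b i) ∘ₗ g i ∘ₗ parityProj C.internal (a i)))) =
      (z • (flatten D.carrier k ∘ₗ PiTensorProduct.map
      (fun i => D.powParity (k i) (b i) ∘ₗ g' i ∘ₗ parityProj D.internal (a i)))) ∘ₗ powMap f n := by
    intro z
    refine (map_zsmul (LinearMap.llcomp R _ _ _ (powMap f _)) z _).trans ?_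
    refine Eq.trans ?_ (map_zsmul (LinearMap.lcomp R _ (powMap f n)) z _).symm
    exact congrArg _ key
  exact hz _

end Naturality

/-! ### Intertwined operations of two coendomorphism operads -/

section CoEnd

variable {C : DGModule.{u, v} R} {D : DGModule.{u, w} R} {f : C.carrier →ₗ[R] D.carrier}

/-- A chain map induces no map between the coendomorphism operads, as `Hom(C, C^{⊗n})` has mixed
variance. Its substitute is the relation `powMap f n ∘ₗ g = g' ∘ₗ f` between `g` and `g'`; this
lemma and the next three show that the operad operations preserve it. -/
theorem powMap_comp_coEnd_d (hf : ∀ k, ∀ x ∈ C.gr k, f x ∈ D.gr k) (hd : f ∘ₗ C.d = D.d ∘ₗ f)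
    {n : ℕ} {g : C.carrier →ₗ[R] C.Pow n} {g' : D.carrier →ₗ[R] D.Pow n}
    (h : powMap f n ∘ₗ g = g' ∘ₗ f) :
    powMap f n ∘ₗ (coEnd C).d n g = (coEnd D).d n g' ∘ₗ f := by
  change powMap f n ∘ₗ (g ∘ₗ C.d - C.powD n ∘ₗ C.powSign n ∘ₗ g ∘ₗ signInv C.internal) =
    (g' ∘ₗ D.d - D.powD n ∘ₗ D.powSign n ∘ₗ g' ∘ₗ signInv D.internal) ∘ₗ f
  refine LinearMap.ext fun x => ?_
  have h1 := LinearMap.congr_fun h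
  have h2 := LinearMap.congr_fun hd
  have h3 := LinearMap.congr_fun (powMap_comp_powD hf hd n)
  have h4 := LinearMap.congr_fun (powMap_comp_powSign hf n)
  have h5 := LinearMap.congr_fun (comp_signInv C.internal D.internal hf)
  simp only [LinearMap.comp_apply, LinearMap.sub_apply, map_sub] at h1 h2 h3 h4 h5 ⊢
  rw [h1, h2, h3, h4, h1, h5]

theorem powMap_comp_coEnd_act (hf : ∀ k, ∀ x ∈ C.gr k, f x ∈ D.gr k) {a b : ℕ}
    (e : Fin a ≃ Fin b) {g : C.carrier →ₗ[R] C.Pow b} {g' : D.carrier →ₗ[R] D.Pow b}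
    (h : powMap f b ∘ₗ g = g' ∘ₗ f) :
    powMap f a ∘ₗ (coEnd C).act e g = (coEnd D).act e g' ∘ₗ f := by
  change powMap f a ∘ₗ C.powPerm e.symm ∘ₗ g = (D.powPerm e.symm ∘ₗ g') ∘ₗ f
  rw [← LinearMap.comp_assoc, powMap_comp_powPerm hf, LinearMap.comp_assoc, h,
    LinearMap.comp_assoc]

theorem powMap_comp_coEnd_one (f : C.carrier →ₗ[R] D.carrier) :
    powMap f 1 ∘ₗ (coEnd C).one = (coEnd D).one ∘ₗ f := by
  refine LinearMap.ext fun x => ?_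
  change powMap f 1 ((PiTensorProduct.subsingletonEquiv (s := fun _ => C.carrier) (0 : Fin 1)).symm x)
    = (PiTensorProduct.subsingletonEquiv (s := fun _ => D.carrier) (0 : Fin 1)).symm (f x)
  rw [PiTensorProduct.subsingletonEquiv_symm_apply', PiTensorProduct.subsingletonEquiv_symm_apply',
    PiTensorProduct.map_tprod]

theorem powMap_comp_coEnd_comp (hf : ∀ k, ∀ x ∈ C.gr k, f x ∈ D.gr k) {n : ℕ} (k : Fin n → ℕ)
    {g : C.carrier →ₗ[R] C.Pow n} {g' : D.carrier →ₗ[R] D.Pow n}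
    {p : ∀ i, C.carrier →ₗ[R] C.Pow (k i)} {p' : ∀ i, D.carrier →ₗ[R] D.Pow (k i)}
    (h : powMap f n ∘ₗ g = g' ∘ₗ f) (hp : ∀ i, powMap f (k i) ∘ₗ p i = p' i ∘ₗ f) :
    powMap f _ ∘ₗ (coEnd C).comp k g p = (coEnd D).comp k g' p' ∘ₗ f := by
  change powMap f _ ∘ₗ coEndTensor C k p ∘ₗ g = (coEndTensor D k p' ∘ₗ g') ∘ₗ f
  rw [← LinearMap.comp_assoc, powMap_comp_coEndTensor hf k hp, LinearMap.comp_assoc, h,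
    LinearMap.comp_assoc]

end CoEnd

/-! ### Degrees in tensor powers -/

section Degrees

variable (C : DGModule.{u, v} R)

/-- The projection of the tensor power onto the part of multidegree `q`. -/
noncomputable def multidegreeProj {n : ℕ} (q : Fin n → ℤ) : C.Pow n →ₗ[R] C.Pow n :=
  PiTensorProduct.map fun i => degreeProj C.internal (q i)

theorem multidegreeProj_mem {n : ℕ} (q : Fin n → ℤ) (t : C.Pow n) :
    multidegreeProj C q t ∈ C.powGr n (∑ i, q i) := by
  induction t using PiTensorProduct.induction_on with
  | smul_tprod r x =>
    rw [map_smul]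
    refine Submodule.smul_mem _ _ (Submodule.subset_span ⟨fun i => degreeProj C.internal (q i) (x i), q, ?_, rfl, ?_⟩)
    · exact fun i => degreeProj_mem _ _ _
    · exact PiTensorProduct.map_tprod _ _
  | add s t hs ht => rw [map_add]; exact add_mem hs ht

theorem multidegreeProj_eq_zero {n : ℕ} {q : Fin n → ℤ} {m : ℤ} (hq : ∑ i, q i ≠ m) {t : C.Pow n}
    (ht : t ∈ C.powGr n m) : multidegreeProj C q t = 0 := by
  refine Submodule.span_induction ?_ (map_zero _) ?_ ?_ ht
  · rintro _ ⟨x, p, hx, hp, rfl⟩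
    -- Different total degrees force different degrees in some factor, and the projection kills that
    -- factor.
    obtain ⟨i, hi⟩ : ∃ i, p i ≠ q i := by
      by_contra! h
      exact hq (by rw [← hp]; exact Finset.sum_congr rfl fun i _ => (h i).symm)
    rw [multidegreeProj, PiTensorProduct.map_tprod]
    refine MultilinearMap.map_coord_zero _ i ?_
    rw [degreeProj_of_mem _ _ (hx i), if_neg hi]
  · intro x y _ _ hx hy
    rw [map_add, hx, hy, add_zero]
  · intro r x _ hx
    rw [map_smul, hx, smul_zero]

/-- Allowing every larger finite set lets two tensors with different supports share one index set in
the additive step of the induction. -/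
theorem exists_sum_multidegreeProj {n : ℕ} (t : C.Pow n) :
    ∃ s : Finset (Fin n → ℤ), ∀ s', s ⊆ s' → ∑ q ∈ s', multidegreeProj C q t = t := by
  classical
  induction t using PiTensorProduct.induction_on with
  | smul_tprod r x =>
    choose F hF hF' using fun i => exists_sum_degreeProj C.internal (x i)
    refine ⟨Fintype.piFinset F, fun s' hs' => ?_⟩
    simp only [map_smul]
    rw [← Finset.smul_sum, ← Finset.sum_subset hs']
    · congr 1
      conv_rhs => rw [← funext hF, MultilinearMap.map_sum_finset]
      exact Finset.sum_congr rfl fun q _ => PiTensorProduct.map_tprod _ _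
    · intro q _ hq
      obtain ⟨i, hi⟩ : ∃ i, q i ∉ F i := by simpa using hq
      rw [multidegreeProj, PiTensorProduct.map_tprod]
      exact MultilinearMap.map_coord_zero _ i (hF' i _ hi)
  | add a b ha hb =>
    obtain ⟨s, hs⟩ := ha
    obtain ⟨s', hs'⟩ := hb
    refine ⟨s ∪ s', fun s'' h => ?_⟩
    simp only [map_add]
    rw [Finset.sum_add_distrib, hs _ (Finset.union_subset_left h),
      hs' _ (Finset.union_subset_right h)]

variable {C} {D : DGModule.{u, w} R} {f : C.carrier →ₗ[R] D.carrier}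

/-- The multidegree projections commute with `powMap f n`. If the image of `t` has degree `m`, the
components of `t` of other total degrees map to zero, hence vanish by injectivity. -/
theorem powMap_mem_powGr_iff (hf : ∀ k, ∀ x ∈ C.gr k, f x ∈ D.gr k) {n : ℕ}
    (hi : Function.Injective (powMap f n)) {m : ℤ} {t : C.Pow n} :
    powMap f n t ∈ D.powGr n m ↔ t ∈ C.powGr n m := by
  constructor
  · intro ht
    obtain ⟨s, hs⟩ := exists_sum_multidegreeProj C t
    rw [← hs s subset_rfl]
    refine Submodule.sum_mem _ fun q _ => ?_
    by_cases hq : ∑ i, q i = m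
    · exact hq ▸ multidegreeProj_mem C q t
    · have h0 : multidegreeProj C q t = 0 := by
        refine hi ?_
        rw [map_zero, ← multidegreeProj_eq_zero D hq ht]
        exact LinearMap.congr_fun (map_comp_map_comm (R := R)
          (fun i : Fin n => comp_degreeProj C.internal D.internal hf (q i))) t
      rw [h0]
      exact zero_mem _
  · intro ht
    refine Submodule.span_induction ?_ (by rw [map_zero]; exact zero_mem _) ?_ ?_ ht
    · rintro _ ⟨x, p, hx, hp, rfl⟩
      exact Submodule.subset_span ⟨fun i => f (x i), p, fun i => hf _ _ (hx i), hp,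
        PiTensorProduct.map_tprod _ _⟩
    · intro x y _ _ hx hy
      rw [map_add]; exact add_mem hx hy
    · intro r x _ hx
      rw [map_smul]; exact Submodule.smul_mem _ _ hx

end Degrees

/-! ### Sub-coalgebra structures on subcomplexes -/

section SubCoalgebra

theorem mem_coEnd_gr_iff {C : DGModule.{u, v} R} {n : ℕ} {k : ℤ} {g : C.carrier →ₗ[R] C.Pow n} :
    g ∈ (⨅ j : ℤ, Submodule.compatibleMaps (C.gr j) (C.powGr n (j + k)) :
      Submodule R (C.carrier →ₗ[R] C.Pow n)) ↔
      ∀ j, ∀ x ∈ C.gr j, g x ∈ C.powGr n (j + k) :=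
  Submodule.mem_iInf _

/-- The inclusion of a subcomplex. -/
def Subcomplex.incl {C : DGModule.{u, v} R} (S : Subcomplex C) :
    S.toDGModule.carrier →ₗ[R] C.carrier :=
  S.toSubmodule.subtype

theorem Subcomplex.incl_mem {C : DGModule.{u, v} R} (S : Subcomplex C) :
    ∀ k, ∀ x ∈ S.toDGModule.gr k, S.incl x ∈ C.gr k :=
  fun _ _ hx => hx

theorem Subcomplex.incl_comp_d {C : DGModule.{u, v} R} (S : Subcomplex C) :
    S.incl ∘ₗ S.toDGModule.d = C.d ∘ₗ S.incl :=
  rfl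

variable {V : Operad.{u, v} R} {C : Coalgebra.{u, v, w} V}

theorem exists_lift_cop (S : Subcomplex C.cx)
    (hinj : ∀ n, Function.Injective (powMap S.incl n))
    (hS : ∀ n v x, C.cop n v (S.incl x) ∈ LinearMap.range (powMap S.incl n)) (n : ℕ) :
    ∃ L : V.obj n →ₗ[R] (S.toDGModule.carrier →ₗ[R] S.toDGModule.Pow n),
      ∀ v, powMap S.incl n ∘ₗ L v = C.cop n v ∘ₗ S.incl := by
  -- Preimages are unique by `hinj`, so the chosen function is bilinear in `v` and `x`.
  choose g hg using fun (v : V.obj n) (x : S.toDGModule.carrier) => hS n v x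
  refine ⟨LinearMap.mk₂ R g ?_ ?_ ?_ ?_, fun v => LinearMap.ext (hg v)⟩
  · intro v v' x
    refine hinj n ?_
    rw [map_add, hg, hg, hg, map_add, LinearMap.add_apply]
  · intro c v x
    refine hinj n ?_
    rw [map_smul, hg, hg, map_smul, LinearMap.smul_apply]
  · intro v x y
    refine hinj n ?_
    rw [map_add, hg, hg, hg, map_add, map_add]
  · intro c v x
    refine hinj n ?_
    rw [map_smul, hg, hg, map_smul, map_smul]

/-- A subcomplex whose tensor powers embed into those of `C` is a sub-coalgebra as soon as the
structure maps take it to its tensor powers. -/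
theorem exists_subCoalgebra (S : Subcomplex C.cx)
    (hinj : ∀ n, Function.Injective (powMap S.incl n))
    (hS : ∀ n v x, C.cop n v (S.incl x) ∈ LinearMap.range (powMap S.incl n)) :
    ∃ A : SubCoalgebra C, A.toSubmodule = S.toSubmodule := by
  choose L hL using exists_lift_cop S hinj hS
  -- Each equational axiom for `L` is verified after composition with the injective `powMap S.incl
  -- n`, where it becomes the axiom for `C.str` restricted to `S`.
  have hcancel : ∀ {n : ℕ} {g g' : S.toDGModule.carrier →ₗ[R] S.toDGModule.Pow n},
      powMap S.incl n ∘ₗ g = powMap S.incl n ∘ₗ g' → g = g' := fun h =>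
    LinearMap.ext fun x => hinj _ (LinearMap.congr_fun h x)
  let str : OperadHom V.toOperadData (coEnd S.toDGModule) :=
    { app := L
      app_mem := by
        intro n k v hv
        refine mem_coEnd_gr_iff.2 fun j x hx => (powMap_mem_powGr_iff S.incl_mem (hinj n)).1 ?_
        have h := mem_coEnd_gr_iff.1 (C.str.app_mem n k v hv) j (S.incl x) (S.incl_mem j x hx)
        exact (LinearMap.congr_fun (hL n v) x).symm ▸ h
      app_d := by
        intro n v
        refine hcancel ?_
        refine (hL _ _).trans (Eq.trans ?_ (powMap_comp_coEnd_d S.incl_mem S.incl_comp_d (hL n v)).symm)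
        exact congrArg (fun g => LinearMap.comp g S.incl) (C.str.app_d n v)
      app_act := by
        intro a b e v
        refine hcancel ?_
        refine (hL _ _).trans (Eq.trans ?_ (powMap_comp_coEnd_act S.incl_mem e (hL b v)).symm)
        exact congrArg (fun g => LinearMap.comp g S.incl) (C.str.app_act e v)
      app_one := by
        refine hcancel ?_
        refine (hL _ _).trans (Eq.trans ?_ (powMap_comp_coEnd_one S.incl).symm)
        exact congrArg (fun g => LinearMap.comp g S.incl) C.str.app_one
      app_comp := by
        intro n k v y
        refine hcancel ?_
        refine (hL _ _).trans (Eq.trans ?_ (powMap_comp_coEnd_comp S.incl_mem k (hL n v)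
          (fun i => hL (k i) (y i))).symm)
        exact congrArg (fun g => LinearMap.comp g S.incl) (C.str.app_comp k v y) }
  exact ⟨⟨S, str, ⟨S.incl_mem, fun _ => rfl, fun n v x => LinearMap.congr_fun (hL n v) x⟩⟩, rfl⟩

end SubCoalgebra

/-! ### Countability, torsion-freeness and flatness -/

section NearlyFree

theorem isPrincipalIdealRing_of_isField_or_int (hR : IsField R ∨ Nonempty (R ≃+* ℤ)) :
    ∃ _ : IsDomain R, IsPrincipalIdealRing R := by
  rcases hR with h | ⟨⟨e⟩⟩
  · let _ := h.toField
    exact ⟨h.isDomain, inferInstance⟩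
  · exact ⟨e.toMulEquiv.isDomain ℤ, IsPrincipalIdealRing.of_surjective e.symm e.symm.surjective⟩

/-- The factors in one expression of `t` as a sum of pure tensors suffice. The set depends on `t`
alone, so it can be chosen before the subcomplex is built. -/
theorem exists_finite_mem_span_tprod {C : DGModule.{u, v} R} {n : ℕ} (t : C.Pow n) :
    ∃ s : Set C.carrier, s.Finite ∧
      ∀ S : Subcomplex C, s ⊆ S.toSubmodule → t ∈ LinearMap.range (powMap S.incl n) := by
  induction t using PiTensorProduct.induction_on with
  | smul_tprod r x =>
    refine ⟨Set.range x, Set.finite_range x, fun S hS => Submodule.smul_mem _ _ ?_⟩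
    refine ⟨PiTensorProduct.tprod R fun i => ⟨x i, hS ⟨i, rfl⟩⟩, ?_⟩
    exact PiTensorProduct.map_tprod _ _
  | add a b ha hb =>
    obtain ⟨s, hs, hs'⟩ := ha
    obtain ⟨t, ht, ht'⟩ := hb
    exact ⟨s ∪ t, hs.union ht, fun S hS => add_mem
      (hs' S (Set.subset_union_left.trans hS)) (ht' S (Set.subset_union_right.trans hS))⟩

variable [Countable R]

theorem countable_span {M : Type*} [AddCommGroup M] [Module R M] {s : Set M} (hs : s.Countable) :
    Countable (Submodule.span R s) := by
  have := hs.to_subtype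
  have h := (inferInstance : Countable (Submodule.span R (Set.range ((↑) : s → M))))
  rwa [Subtype.range_coe] at h

theorem Operad.Admissible.countable {V : Operad.{u, v} R} (hV : V.Admissible) (n : ℕ) :
    Countable (V.obj n) := by
  have (k : ℤ) : Countable (V.gr n k) :=
    have : Module.Finite R (V.gr n k) := Module.Finite.iff_fg.2 (hV.finite_type n k)
    Finsupp.Countable.of_moduleFinite (R := R)
  have : Countable (DirectSum ℤ fun k => V.gr n k) :=
    inferInstanceAs (Countable (Π₀ k, V.gr n k))
  exact (V.internal n).surjective.countable

/-- A cyclic submodule is countable because `R` is, so it is free, and a free module over a domain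
has no torsion. -/
theorem NearlyFree.isTorsionFree [IsDomain R] {M : Type v} [AddCommGroup M] [Module R M]
    (h : NearlyFree R M) : Module.IsTorsionFree R M := by
  refine .of_smul_eq_zero fun r x hrx => ?_
  have := h (Submodule.span R {x}) (countable_span (Set.countable_singleton x))
  have hx : r • (⟨x, Submodule.mem_span_singleton_self x⟩ : Submodule.span R {x}) = 0 :=
    Subtype.ext hrx
  exact (smul_eq_zero.1 hx).imp id (congrArg Subtype.val)

/-- Submodules of a nearly free module have tensor powers that embed. -/
theorem NearlyFree.powMap_injective {C : DGModule.{u, v} R}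
    (hR : IsField R ∨ Nonempty (R ≃+* ℤ)) (hC : NearlyFree R C.carrier) (S : Subcomplex C)
    (n : ℕ) : Function.Injective (powMap S.incl n) := by
  obtain ⟨_, _⟩ := isPrincipalIdealRing_of_isField_or_int hR
  have := hC.isTorsionFree
  -- Torsion-freeness passes to submodules and gives flatness of both modules over the principal
  -- ideal domain `R`.
  have : Module.IsTorsionFree R S.toDGModule.carrier :=
    inferInstanceAs (Module.IsTorsionFree R S.toSubmodule)
  exact (pow_flat_and_map_injective S.incl S.toSubmodule.injective_subtype n).2.2

end NearlyFree

/-! ### Countable closure -/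

section Countable

variable [Countable R]

/-- Every countable set lies in a countable submodule that contains the countable set `G x` for each
of its elements `x`. -/
theorem exists_countable_submodule_closed {M : Type v} [AddCommGroup M] [Module R M]
    (G : M → Set M) (hG : ∀ x, (G x).Countable) (s : Set M) (hs : s.Countable) :
    ∃ N : Submodule R M, Countable N ∧ s ⊆ N ∧ ∀ x ∈ N, G x ⊆ N := by
  -- Stage `i + 1` adjoins `G x` for every `x` of stage `i`. An element of the union appears at a
  -- finite stage, so its `G x` appears one stage later.
  let F : ℕ → {N : Submodule R M // Countable N} := fun i =>
    Nat.rec ⟨Submodule.span R s, countable_span hs⟩ (fun _ N =>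
      ⟨Submodule.span R (N.1 ∪ ⋃ x ∈ (N.1 : Set M), G x), countable_span (by
        have : (N.1 : Set M).Countable := N.2.to_set
        exact this.union (this.biUnion fun x _ => hG x))⟩) i
  have hF : ∀ i, (F i).1 ≤ (F (i + 1)).1 := fun i x hx =>
    Submodule.subset_span (Or.inl hx)
  have hmem : ∀ x, x ∈ (⨆ i, (F i).1) ↔ ∃ i, x ∈ (F i).1 := fun x =>
    Submodule.mem_iSup_of_directed _ (monotone_nat_of_le_succ hF).directed_le
  refine ⟨⨆ i, (F i).1, ?_, ?_, ?_⟩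
  · have h : ((⨆ i, (F i).1 : Submodule R M) : Set M) = ⋃ i, ((F i).1 : Set M) := by
      ext x; simpa using hmem x
    have h2 : ((⨆ i, (F i).1 : Submodule R M) : Set M).Countable := by
      rw [h]
      exact Set.countable_iUnion fun i => (F i).2.to_set
    exact h2.to_subtype
  · exact fun x hx => (hmem x).2 ⟨0, Submodule.subset_span hx⟩
  · intro x hx y hy
    obtain ⟨i, hi⟩ := (hmem x).1 hx
    exact (hmem y).2 ⟨i + 1, Submodule.subset_span (Or.inr (Set.mem_biUnion hi hy))⟩

variable {V : Operad.{u, v} R} {C : Coalgebra.{u, v, w} V}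

/-- Every countable set lies in a countable sub-coalgebra. -/
theorem exists_countable_subCoalgebra (hR : IsField R ∨ Nonempty (R ≃+* ℤ)) (hV : V.Admissible)
    (hC : NearlyFree R C.cx.carrier) (s : Set C.cx.carrier) (hs : s.Countable) :
    ∃ A : SubCoalgebra C, Countable A.toSubmodule ∧ s ⊆ A.toSubmodule := by
  choose T hT hT' using fun (n : ℕ) (t : C.cx.Pow n) => exists_finite_mem_span_tprod t
  have := hV.countable
  -- Closure under `d` and the degree projections makes `N` a subcomplex; closure under the sets `T`
  -- puts the coproducts of its elements into the image of its tensor powers.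
  obtain ⟨N, hN, hsN, hclosed⟩ := exists_countable_submodule_closed (R := R)
    (fun x => {C.cx.d x} ∪ (⋃ k, {degreeProj C.cx.internal k x}) ∪
      ⋃ n, ⋃ v : V.obj n, T n (C.cop n v x))
    (fun x => ((Set.countable_singleton _).union
      (Set.countable_iUnion fun k => Set.countable_singleton _)).union
      (Set.countable_iUnion fun n => Set.countable_iUnion fun v => (hT n _).countable)) s hs
  let S : Subcomplex C.cx :=
    { toSubmodule := N
      graded := fun x hx => by
        obtain ⟨F, hF, -⟩ := exists_sum_degreeProj C.cx.internal x
        rw [← hF]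
        refine Submodule.sum_mem _ fun k _ => Submodule.mem_iSup_of_mem k ⟨?_, ?_⟩
        · exact hclosed x hx (Or.inl (Or.inr (Set.mem_iUnion.2 ⟨k, rfl⟩)))
        · exact degreeProj_mem _ _ _
      d_mem := fun x hx => hclosed x hx (Or.inl (Or.inl rfl)) }
  obtain ⟨A, hA⟩ := exists_subCoalgebra S (hC.powMap_injective hR S) fun n v x =>
    hT' n _ S fun y hy => hclosed x.1 x.2
      (Or.inr (Set.mem_iUnion.2 ⟨n, Set.mem_iUnion.2 ⟨v, hy⟩⟩))
  refine ⟨A, ?_, ?_⟩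
  · rw [hA]; exact hN
  · rw [hA]; exact hsN

end Countable

/-! ### Gluing along a directed family of sub-coalgebras -/

section Colimit

variable {V : Operad.{u, v} R} {C : Coalgebra.{u, v, w} V}

/-- Inclusions of sub-coalgebras are morphisms of coalgebras if the tensor powers embed. -/
theorem SubCoalgebra.isCoalgebraHom_inclusion {A B : SubCoalgebra C}
    (hB : ∀ n, Function.Injective (powMap B.sub.incl n)) (h : A.toSubmodule ≤ B.toSubmodule) :
    IsCoalgebraHom A.toCoalgebra B.toCoalgebra (Submodule.inclusion h) := by
  -- Both sides agree in the tensor power of `C`, because the two inclusions into `C` are morphisms;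
  -- injectivity for `B` brings the equality back.
  refine ⟨fun k x hx => hx, fun x => rfl, fun n v x => hB n ?_⟩
  refine Eq.trans ?_ (B.incl.map_str n v (Submodule.inclusion h x)).symm
  refine Eq.trans ?_ (A.incl.map_str n v x)
  exact (LinearMap.congr_fun (PiTensorProduct.map_comp (R := R) (fun _ : Fin n => B.sub.incl)
    (fun _ => (Submodule.inclusion h : A.sub.toDGModule.carrier →ₗ[R] _))) _).symm

variable {D : Coalgebra.{u, v, u'} V}

/-- A linear map whose restrictions to sub-coalgebras that cover `C` are morphisms of coalgebras is
a morphism of coalgebras. -/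
theorem isCoalgebraHom_of_restrict {ψ : C.cx.carrier →ₗ[R] D.cx.carrier}
    (h : ∀ x, ∃ A : SubCoalgebra C, x ∈ A.toSubmodule ∧
      IsCoalgebraHom A.toCoalgebra D (ψ ∘ₗ A.toSubmodule.subtype)) : IsCoalgebraHom C D ψ := by
  refine ⟨fun k x hx => ?_, fun x => ?_, fun n v x => ?_⟩
  · obtain ⟨A, hxA, hA⟩ := h x
    exact hA.map_mem k ⟨x, hxA⟩ hx
  · obtain ⟨A, hxA, hA⟩ := h x
    exact hA.map_d ⟨x, hxA⟩
  · obtain ⟨A, hxA, hA⟩ := h x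
    -- The coproduct of `x` in `C` is the image of its coproduct in `A`, so only the restriction of
    -- `ψ` to `A` matters.
    refine Eq.trans ?_ (hA.map_str n v ⟨x, hxA⟩)
    refine (congrArg _ (A.incl.map_str n v ⟨x, hxA⟩)).symm.trans ?_
    exact (LinearMap.congr_fun (PiTensorProduct.map_comp (R := R) (fun _ : Fin n => ψ)
      (fun _ => A.sub.incl)) _).symm

/-- A compatible family of linear maps on a directed family of submodules that covers `M` comes
from a linear map on `M`. -/
theorem exists_linearMap_of_directed {M : Type v} {N : Type w} [AddCommGroup M] [Module R M]
    [AddCommGroup N] [Module R N] {ι : Type*} (S : ι → Submodule R M)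
    (hdir : Directed (· ≤ ·) S) (hcov : ∀ x, ∃ i, x ∈ S i) (φ : ∀ i, S i →ₗ[R] N)
    (hφ : ∀ i j (h : S i ≤ S j), φ j ∘ₗ Submodule.inclusion h = φ i) :
    ∃ ψ : M →ₗ[R] N, ∀ i, ψ ∘ₗ (S i).subtype = φ i := by
  choose c hc using hcov
  -- The value at `x` does not depend on the chosen index: two indices are compared in a common
  -- upper bound.
  have key : ∀ i x (hx : x ∈ S i), φ (c x) ⟨x, hc x⟩ = φ i ⟨x, hx⟩ := by
    intro i x hx
    obtain ⟨k, hk, hk'⟩ := hdir (c x) i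
    rw [← hφ _ _ hk, ← hφ _ _ hk']
    rfl
  refine ⟨{ toFun := fun x => φ (c x) ⟨x, hc x⟩, map_add' := ?_, map_smul' := ?_ },
    fun i => LinearMap.ext fun x => key i x.1 x.2⟩
  · intro x y
    obtain ⟨k, hk, hk'⟩ := hdir (c x) (c y)
    rw [key k _ (hk (hc x)), key k _ (hk' (hc y)), key k _ (add_mem (hk (hc x)) (hk' (hc y))),
      ← map_add]
    rfl
  · intro r x
    rw [key (c x) _ (Submodule.smul_mem _ r (hc x)), RingHom.id_apply, ← map_smul]
    rfl

end Colimit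

end DGOperad

theorem theoremB6 {R : Type u} [CommRing R] [Countable R]
    (hR : IsField R ∨ Nonempty (R ≃+* ℤ))
    (V : DGOperad.Operad.{u, v} R) (hV : V.Admissible)
    (C : DGOperad.Coalgebra.{u, v, w} V) (hC : DGOperad.NearlyFree R C.cx.carrier) :
    (∀ A B : DGOperad.SubCoalgebra C, Countable A.toSubmodule → Countable B.toSubmodule →
      ∃ E : DGOperad.SubCoalgebra C, Countable E.toSubmodule ∧
        A.toSubmodule ≤ E.toSubmodule ∧ B.toSubmodule ≤ E.toSubmodule) ∧
    (∀ A B : DGOperad.SubCoalgebra C, Countable A.toSubmodule → Countable B.toSubmodule →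
      ∀ h : A.toSubmodule ≤ B.toSubmodule,
        DGOperad.IsCoalgebraHom A.toCoalgebra B.toCoalgebra (Submodule.inclusion h)) ∧
    (∀ x : C.cx.carrier, ∃ A : DGOperad.SubCoalgebra C,
      Countable A.toSubmodule ∧ x ∈ A.toSubmodule) ∧
    (∀ (D : DGOperad.Coalgebra.{u, v, u'} V)
      (φ : ∀ A : DGOperad.SubCoalgebra C, Countable A.toSubmodule →
        A.toSubmodule →ₗ[R] D.cx.carrier),
      (∀ A hA, DGOperad.IsCoalgebraHom A.toCoalgebra D (φ A hA)) →
      (∀ A B hA hB (h : A.toSubmodule ≤ B.toSubmodule),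
        φ B hB ∘ₗ Submodule.inclusion h = φ A hA) →
      ∃! ψ : C.cx.carrier →ₗ[R] D.cx.carrier, DGOperad.IsCoalgebraHom C D ψ ∧
        ∀ A hA, ψ ∘ₗ A.toSubmodule.subtype = φ A hA) := by
  have hinj := fun S : DGOperad.Subcomplex C.cx => hC.powMap_injective hR S
  have hdir : ∀ A B : DGOperad.SubCoalgebra C, Countable A.toSubmodule →
      Countable B.toSubmodule → ∃ E : DGOperad.SubCoalgebra C, Countable E.toSubmodule ∧
        A.toSubmodule ≤ E.toSubmodule ∧ B.toSubmodule ≤ E.toSubmodule := by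
    intro A B hA hB
    obtain ⟨E, hE, h⟩ := DGOperad.exists_countable_subCoalgebra hR hV hC
      ((A.toSubmodule : Set C.cx.carrier) ∪ B.toSubmodule) (hA.to_set.union hB.to_set)
    exact ⟨E, hE, Set.union_subset_iff.1 h⟩
  have hcov : ∀ x : C.cx.carrier, ∃ A : DGOperad.SubCoalgebra C,
      Countable A.toSubmodule ∧ x ∈ A.toSubmodule := by
    intro x
    obtain ⟨A, hA, h⟩ := DGOperad.exists_countable_subCoalgebra hR hV hC {x}
      (Set.countable_singleton x)
    exact ⟨A, hA, h rfl⟩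
  refine ⟨hdir, fun A B _ _ h => DGOperad.SubCoalgebra.isCoalgebraHom_inclusion (hinj B.sub) h,
    hcov, fun D φ hφ hcomp => ?_⟩
  obtain ⟨ψ, hψ⟩ := DGOperad.exists_linearMap_of_directed
    (fun A : {A : DGOperad.SubCoalgebra C // Countable A.toSubmodule} => A.1.toSubmodule)
    (fun A B => by
      obtain ⟨E, hE, h⟩ := hdir A.1 B.1 A.2 B.2
      exact ⟨⟨E, hE⟩, h⟩)
    (fun x => by
      obtain ⟨A, hA, h⟩ := hcov x
      exact ⟨⟨A, hA⟩, h⟩)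
    (fun A => φ A.1 A.2) (fun A B h => hcomp A.1 B.1 A.2 B.2 h)
  refine ⟨ψ, ⟨DGOperad.isCoalgebraHom_of_restrict fun x => ?_, fun A hA => hψ ⟨A, hA⟩⟩, ?_⟩
  · obtain ⟨A, hA, hx⟩ := hcov x
    have h : ψ ∘ₗ A.toSubmodule.subtype = φ A hA := hψ ⟨A, hA⟩
    exact ⟨A, hx, (congrArg (DGOperad.IsCoalgebraHom A.toCoalgebra D) h).mpr (hφ A hA)⟩
  · rintro ψ' ⟨-, hψ'⟩
    refine LinearMap.ext fun x => ?_
    obtain ⟨A, hA, hx⟩ := hcov x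
    exact LinearMap.congr_fun ((hψ' A hA).trans (hψ ⟨A, hA⟩).symm) ⟨x, hx⟩
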